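/- Proposition (prox-regular implies super-regular). Let $E$ be a Euclidean space (a finite-dimensional real inner product space, for example $\mathbb{R}^n$), let $C \subset E$ be a closed set, and let $\bar x \in C$. For $u \in E$, let $P_C(u) = \{ y \in C : \|y-u\| \le \|w-u\| \text{ for all } w \in C \}$ denote the set of points of $C$ nearest to $u$. Suppose that $C$ is prox-regular at $\bar x$, in the sense that $P_C$ is single-valued around $\bar x$: there is $\epsilon > 0$ such that $P_C(u)$ consists of exactly one point for every $u \in E$ with $\|u - \bar x\| < \epsilon$. Then $C$ is super-regular at $\bar x$: for every $\delta > 0$ there is $\epsilon > 0$ such that, for all $u \in E$ and $z \in C$ with $\|u-\bar x\| < \epsilon$ and $\|z - \bar x\| < \epsilon$, and all $y \in P_C(u)$, \[ \langle z-y,\, u-y\rangle \le \delta\, \|z-y\|\,\|u-y\| . \] -/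

import Mathlib

/-- The (multivalued) projection `P_C(u)`: the set of all points of `C` nearest to `u`. -/
def nearestPointSet {E : Type*} [NormedAddCommGroup E] (C : Set E) (u : E) : Set E :=
  {y | y ∈ C ∧ ∀ w ∈ C, ‖y - u‖ ≤ ‖w - u‖}

/-- `C` is prox-regular at `x`: the projection mapping `P_C` is single-valued around `x`, that is,
every point of some neighbourhood of `x` has exactly one nearest point in `C`. -/
def ProxRegularAt {E : Type*} [NormedAddCommGroup E] (C : Set E) (x : E) : Prop :=
  ∃ ε > 0, ∀ u ∈ Metric.ball x ε, ∃! y, y ∈ nearestPointSet C u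

/-- `C` is super-regular at `x`: for every `δ > 0`, all points `u`, `z` near `x` with `z ∈ C`, and
all `y ∈ P_C(u)`, satisfy `⟪z - y, u - y⟫ ≤ δ ‖z - y‖ ‖u - y‖`. -/
def SuperRegularAt {E : Type*} [NormedAddCommGroup E] [InnerProductSpace ℝ E]
    (C : Set E) (x : E) : Prop :=
  ∀ δ > 0, ∃ ε > 0, ∀ u ∈ Metric.ball x ε, ∀ z ∈ Metric.ball x ε, z ∈ C →
    ∀ y ∈ nearestPointSet C u, inner ℝ (z - y) (u - y) ≤ δ * ‖z - y‖ * ‖u - y‖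

/-! If `y` is nearest to `y + v`, expanding squares gives `2⟪z - y, v⟫ ≤ ‖z - y‖²`. With `v = T • (u
- y)` of length above a fixed `r / 4`, this yields super-regularity once `‖z - y‖` is small. Such a
`v` is reached by repeated doubling (`mem_nearestPointSet_double`): the farthest point from `C` in
the ball around `u` through `y` must be the antipode of `y`, because uniqueness of projections makes
the distance grow in every direction acute to `a - p`. -/

open Filter Topology in
/-- If `p` is the unique nearest point of `C` to `a`, the distance to `C` strictly increases from `a`
in every direction making an acute angle with `a - p`. -/
theorem eventually_infDist_lt_of_inner_pos {E : Type*} [NormedAddCommGroup E]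
    [InnerProductSpace ℝ E] [FiniteDimensional ℝ E] {C : Set E} (hC : IsClosed C) {a p w : E}
    (hp : p ∈ nearestPointSet C a) (huniq : ∀ q ∈ nearestPointSet C a, q = p)
    (hw : 0 < inner ℝ w (a - p)) :
    ∀ᶠ t in 𝓝[>] (0 : ℝ), Metric.infDist a C < Metric.infDist (a + t • w) C := by
  have hne : C.Nonempty := ⟨p, hp.1⟩
  -- Otherwise some `t n → 0⁺` do not increase the distance. Nearest points `q n` to `a + t n • w`
  -- subconverge to `p` by uniqueness, while expanding squares forces `⟪w, a - q n⟫ ≤ 0`,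
  -- contradicting `hw` in the limit.
  by_contra hcon
  rw [not_eventually] at hcon
  obtain ⟨t, ht, hle⟩ := exists_seq_forall_of_frequently hcon
  have hpos : ∀ᶠ n in atTop, 0 < t n :=
    ht.eventually (eventually_mem_nhdsWithin)
  have ht0 : Tendsto t atTop (𝓝 0) := tendsto_nhds_of_tendsto_nhdsWithin ht
  have hpt : Tendsto (fun n => a + t n • w) atTop (𝓝 a) := by
    simpa using (ht0.smul_const w).const_add a
  choose q hqC hq using fun n => hC.exists_infDist_eq_dist hne (a + t n • w)
  have hqb : ∀ n, dist (q n) (a + t n • w) ≤ dist a p := fun n => by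
    rw [dist_comm, ← hq n]
    exact (not_lt.1 (hle n)).trans (Metric.infDist_le_dist_of_mem hp.1)
  obtain ⟨R, hR⟩ := (Metric.isBounded_range_of_tendsto _ hpt).subset_closedBall a
  have hqR : ∀ n, q n ∈ Metric.closedBall a (dist a p + R) := fun n => by
    have h1 : dist (a + t n • w) a ≤ R := hR ⟨n, rfl⟩
    rw [Metric.mem_closedBall]
    linarith [dist_triangle (q n) (a + t n • w) a, hqb n]
  obtain ⟨b, -, φ, hφ, hb⟩ := (isCompact_closedBall a (dist a p + R)).tendsto_subseq hqR
  have hbC : b ∈ C := hC.mem_of_tendsto hb (Eventually.of_forall fun n => hqC _)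
  have hba : dist b a ≤ dist a p :=
    le_of_tendsto (hb.dist (hpt.comp hφ.tendsto_atTop)) (Eventually.of_forall fun n => hqb _)
  have hbp : b = p := huniq b ⟨hbC, fun v hv => by
    rw [← dist_eq_norm, ← dist_eq_norm]
    refine hba.trans ?_
    simpa [dist_eq_norm, norm_sub_rev] using hp.2 v hv⟩
  subst hbp
  have hlim : Tendsto (fun n => inner ℝ w (a - q (φ n))) atTop (𝓝 (inner ℝ w (a - b))) :=
    tendsto_const_nhds.inner (tendsto_const_nhds.sub hb)
  refine absurd (le_of_tendsto hlim ?_) (not_le.2 hw)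
  filter_upwards [hφ.tendsto_atTop.eventually hpos] with n hn
  have h1 := hqb (φ n)
  have h2 := hp.2 _ (hqC (φ n))
  rw [dist_comm, dist_eq_norm, dist_eq_norm,
    show a + t (φ n) • w - q (φ n) = (a - q (φ n)) + t (φ n) • w by abel] at h1
  rw [norm_sub_rev, norm_sub_rev (q (φ n))] at h2
  have h3 := norm_add_sq_real (a - q (φ n)) (t (φ n) • w)
  rw [real_inner_smul_right, real_inner_comm] at h3
  have h4 := pow_le_pow_left₀ (norm_nonneg _) h1 2
  have h5 := pow_le_pow_left₀ (norm_nonneg _) h2 2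
  by_contra hneg
  have := mul_pos hn (not_le.1 hneg)
  nlinarith [sq_nonneg ‖t (φ n) • w‖]

-- `‖a + t • w‖²` has slope `2⟪w, a⟫ < 0` at `t = 0`. This keeps a perturbed boundary point inside
-- the ball.
open Filter Topology in
theorem eventually_norm_add_smul_le {E : Type*} [NormedAddCommGroup E] [InnerProductSpace ℝ E]
    {a w : E} (hw : inner ℝ w a < 0) : ∀ᶠ t in 𝓝[>] (0 : ℝ), ‖a + t • w‖ ≤ ‖a‖ := by
  have hlim : Tendsto (fun t : ℝ => 2 * inner ℝ w a + t * ‖w‖ ^ 2) (𝓝[>] 0)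
      (𝓝 (2 * inner ℝ w a)) := by
    refine tendsto_nhdsWithin_of_tendsto_nhds ?_
    have : Continuous fun t : ℝ => 2 * inner ℝ w a + t * ‖w‖ ^ 2 := by fun_prop
    simpa using this.tendsto 0
  filter_upwards [hlim.eventually_lt_const (by linarith : 2 * inner ℝ w a < 0),
    eventually_mem_nhdsWithin] with t h1 (h2 : 0 < t)
  refine (sq_le_sq₀ (norm_nonneg _) (norm_nonneg _)).1 ?_
  rw [norm_add_sq_real, real_inner_smul_right, real_inner_comm, norm_smul, mul_pow,
    Real.norm_eq_abs, sq_abs]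
  nlinarith [mul_neg_of_pos_of_neg h2 h1]

/-- If points near the segment have unique nearest points, then a proximal normal segment from `y`
to `u` may be doubled in length. -/
theorem mem_nearestPointSet_double {E : Type*} [NormedAddCommGroup E] [InnerProductSpace ℝ E]
    [FiniteDimensional ℝ E] {C : Set E} (hC : IsClosed C) {u y : E}
    (hy : y ∈ nearestPointSet C u)
    (huniq : ∀ a ∈ Metric.closedBall u ‖u - y‖, ∃! q, q ∈ nearestPointSet C a) :
    y ∈ nearestPointSet C (u + (u - y)) := by
  rcases eq_or_ne u y with rfl | hne
  · simpa using hy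
  have hs : 0 < ‖u - y‖ := norm_pos_iff.2 (sub_ne_zero.2 hne)
  have hdist : ∀ {a q : E}, q ∈ nearestPointSet C a → Metric.infDist a C = ‖a - q‖ :=
    fun {a q} hq => by
      rw [← dist_eq_norm]
      refine le_antisymm (Metric.infDist_le_dist_of_mem hq.1)
        ((Metric.le_infDist ⟨q, hq.1⟩).2 fun v hv => ?_)
      simpa [dist_eq_norm, norm_sub_rev] using hq.2 v hv
  obtain ⟨a, ha, hmax⟩ := (isCompact_closedBall u ‖u - y‖).exists_isMaxOn
    ⟨u, Metric.mem_closedBall_self hs.le⟩ (Metric.continuous_infDist_pt C).continuousOn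
  obtain ⟨p, hp, hpu⟩ := huniq a ha
  have hup : ‖u - y‖ ≤ ‖a - p‖ := by
    rw [← hdist hy, ← hdist hp]
    exact hmax (Metric.mem_closedBall_self hs.le)
  have key : ∀ w, 0 < inner ℝ w (a - p) →
      ¬ ∀ᶠ t in nhdsWithin (0 : ℝ) (Set.Ioi 0), a + t • w ∈ Metric.closedBall u ‖u - y‖ := by
    intro w hw hev
    obtain ⟨t, h1, h2⟩ := (hev.and (eventually_infDist_lt_of_inner_pos hC hp hpu hw)).exists
    exact absurd (hmax h1) (not_le.2 h2)
  have hb : 0 < ‖a - p‖ := hs.trans_le hup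
  have hau : ‖a - u‖ = ‖u - y‖ := by
    refine le_antisymm (by simpa [dist_eq_norm] using ha) (not_lt.1 fun hlt => ?_)
    refine key (a - p) (by rw [real_inner_self_eq_norm_sq]; positivity) ?_
    have hc : Continuous fun t : ℝ => a + t • (a - p) := by fun_prop
    have : Metric.ball u ‖u - y‖ ∈ nhds (a + (0 : ℝ) • (a - p)) :=
      Metric.isOpen_ball.mem_nhds (by simpa [dist_eq_norm] using hlt)
    filter_upwards [nhdsWithin_le_nhds (hc.continuousAt this)] with t ht
    exact Metric.ball_subset_closedBall ht
  have hpar : inner ℝ (a - u) (a - p) = ‖a - u‖ * ‖a - p‖ := by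
    by_contra hcs
    have hlt := lt_of_le_of_ne (real_inner_le_norm (a - u) (a - p)) hcs
    have ha0 : 0 < ‖a - u‖ := hau ▸ hs
    -- the direction is the difference of the two normalised vectors, up to a positive factor
    let w := ‖a - u‖ • (a - p) - ‖a - p‖ • (a - u)
    refine key w ?_ ?_
    · rw [inner_sub_left, real_inner_smul_left, real_inner_smul_left, real_inner_self_eq_norm_sq]
      nlinarith
    · have hw : inner ℝ w (a - u) < 0 := by
        rw [inner_sub_left, real_inner_smul_left, real_inner_smul_left,
          real_inner_self_eq_norm_sq, real_inner_comm (a - u) (a - p)]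
        nlinarith
      filter_upwards [eventually_norm_add_smul_le hw] with t ht
      rw [Metric.mem_closedBall, dist_eq_norm, add_sub_right_comm, ← hau]
      exact ht
  have hpar' := inner_eq_norm_mul_iff_real.1 hpar
  set k := ‖a - p‖ / ‖u - y‖ with hk
  have hk1 : 1 ≤ k := (one_le_div hs).2 hup
  have hkb : ‖a - p‖ = k * ‖u - y‖ := by rw [hk]; field_simp
  have hap : a - p = k • (a - u) := by
    rw [hau, hkb, mul_comm, mul_smul] at hpar'
    exact (smul_right_injective E hs.ne' hpar').symm
  -- Since `k ≥ 1`, `u` lies on the segment from `p` to `a`, so `p` is also nearest to `u`.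
  have hpy : p = y := by
    have hu : u ∈ Metric.closedBall u ‖u - y‖ := Metric.mem_closedBall_self hs.le
    refine (huniq u hu).unique ⟨hp.1, fun v hv => ?_⟩ hy
    have h1 : p - u = (1 - k) • (a - u) := by
      rw [sub_smul, ← hap]; module
    have h2 := hp.2 v hv
    have h3 := norm_sub_le_norm_sub_add_norm_sub v u a
    rw [norm_sub_rev p, hkb] at h2
    rw [norm_sub_rev u a, hau] at h3
    rw [h1, norm_smul, hau, Real.norm_eq_abs, abs_of_nonpos (by linarith)]
    linarith
  subst hpy
  have hk2 : k = 2 := by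
    have h1 : u - p = (k - 1) • (a - u) := by
      rw [sub_smul, ← hap]; module
    have h2 : ‖u - p‖ = (k - 1) * ‖u - p‖ := by
      conv_lhs => rw [h1, norm_smul, hau, Real.norm_eq_abs, abs_of_nonneg (by linarith)]
    have : (k - 2) * ‖u - p‖ = 0 := by linarith
    linarith [(mul_eq_zero.1 this).resolve_right hs.ne']
  have hax : u + (u - p) = a := by
    rw [hk2] at hap
    linear_combination (norm := module) hap
  rwa [hax]

/-- A point `y` nearest to `y + v` satisfies the proximal normal inequality. -/
theorem two_mul_inner_le_of_mem_nearestPointSet {E : Type*} [NormedAddCommGroup E]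
    [InnerProductSpace ℝ E] {C : Set E} {y v z : E} (hy : y ∈ nearestPointSet C (y + v))
    (hz : z ∈ C) : 2 * inner ℝ (z - y) v ≤ ‖z - y‖ ^ 2 := by
  have h := pow_le_pow_left₀ (norm_nonneg _) (hy.2 z hz) 2
  rw [sub_add_cancel_left, norm_neg, ← sub_sub, norm_sub_sq_real] at h
  linarith

theorem mainTheorem8 {E : Type*} [NormedAddCommGroup E] [InnerProductSpace ℝ E]
    [FiniteDimensional ℝ E] (C : Set E) (hC : IsClosed C) (x : E) (hx : x ∈ C)
    (hprox : ProxRegularAt C x) : SuperRegularAt C x := by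
  obtain ⟨r, hr, huniq⟩ := hprox
  intro δ hδ
  -- As `‖y - x‖ ≤ 2‖u - x‖`, the bound `r / 4` keeps each doubling ball inside the `r`-ball (`r/4 +
  -- r/4 + r/2`), and `r * δ / 6` gives `‖z - y‖ ≤ r * δ / 2`.
  refine ⟨min (r / 4) (r * δ / 6), by positivity, fun u hu z hz hzC y hy => ?_⟩
  rw [Metric.mem_ball, dist_eq_norm, lt_min_iff] at hu hz
  rcases eq_or_ne u y with rfl | hne
  · simp
  have hs : 0 < ‖u - y‖ := norm_pos_iff.2 (sub_ne_zero.2 hne)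
  have huy : ‖u - y‖ ≤ ‖u - x‖ := by
    simpa [norm_sub_rev] using hy.2 x hx
  have hyx : ‖y - x‖ ≤ 2 * ‖u - x‖ := by
    have := norm_sub_le_norm_sub_add_norm_sub y u x
    rw [norm_sub_rev y u] at this
    linarith
  have hex : ∃ n : ℕ, r / 4 < 2 ^ n * ‖u - y‖ := by
    obtain ⟨n, hn⟩ := pow_unbounded_of_one_lt (r / 4 / ‖u - y‖) (one_lt_two)
    exact ⟨n, (div_lt_iff₀ hs).1 hn⟩
  have hmem : ∀ n : ℕ, (∀ m < n, 2 ^ m * ‖u - y‖ ≤ r / 4) →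
      y ∈ nearestPointSet C (y + (2 ^ n : ℝ) • (u - y)) := by
    intro n
    induction n with
    | zero => intro _; simpa using hy
    | succ n ih =>
      intro hm
      have hn := hm n n.lt_succ_self
      have hnorm : ‖(2 ^ n : ℝ) • (u - y)‖ = 2 ^ n * ‖u - y‖ := by
        rw [norm_smul, Real.norm_of_nonneg (by positivity)]
      have := mem_nearestPointSet_double hC (ih fun m h => hm m (h.trans n.lt_succ_self)) ?_
      · rwa [add_sub_cancel_left, add_assoc, ← two_smul ℝ, smul_smul, ← pow_succ'] at this
      · intro a ha
        rw [add_sub_cancel_left, hnorm, Metric.mem_closedBall] at ha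
        refine huniq a ?_
        have h1 : dist (y + (2 ^ n : ℝ) • (u - y)) y = 2 ^ n * ‖u - y‖ := by
          rw [dist_eq_norm, add_sub_cancel_left, hnorm]
        have h2 := dist_triangle4 a (y + (2 ^ n : ℝ) • (u - y)) y x
        rw [dist_eq_norm y x] at h2
        rw [Metric.mem_ball]
        linarith
  classical
  have hN := hmem (Nat.find hex) fun m h => not_lt.1 (Nat.find_min hex h)
  have hlarge := Nat.find_spec hex
  set T : ℝ := 2 ^ Nat.find hex
  have hT : 0 < T := by positivity
  have hineq := two_mul_inner_le_of_mem_nearestPointSet hN hzC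
  rw [real_inner_smul_right] at hineq
  have hzy : ‖z - y‖ ≤ r * δ / 2 := by
    have := norm_sub_le_norm_sub_add_norm_sub z x y
    rw [norm_sub_rev x y] at this
    linarith
  have h1 : ‖z - y‖ ≤ 2 * T * (δ * ‖u - y‖) := by
    nlinarith [mul_lt_mul_of_pos_right hlarge hδ]
  have h2 : 2 * T * inner ℝ (z - y) (u - y) ≤ 2 * T * (δ * ‖z - y‖ * ‖u - y‖) := by
    nlinarith [mul_le_mul_of_nonneg_left h1 (norm_nonneg (z - y))]
  exact le_of_mul_le_mul_left h2 (by positivity)
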